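/- Let $c>0$ and $D\ge 0$ be real numbers. There exist constants $N(c,D)$ and $\gamma(c,D)>0$, depending only on $c$ and $D$, such that the following holds. Let $\mathcal{X}$ be a measurable space equipped with a metric $\ell$ all of whose open balls are measurable. For $\varepsilon>0$ let $\mathcal{N}(\mathcal{X},\ell,\varepsilon)\in\mathbb{N}\cup\{\infty\}$ be the supremum of the integers $k$ such that $\mathcal{X}$ contains $k$ pairwise disjoint $\ell$-open balls of radius $\varepsilon$, and assume that $$\mathcal{N}(\mathcal{X},\ell,\varepsilon)\ \ge\ c\,\varepsilon^{-D}\quad\text{and}\quad \mathcal{N}(\mathcal{X},\ell,\varepsilon)\ \ge\ 2\qquad\text{for all } 0<\varepsilon<1/2 .$$ A bandit environment $M=(M_x)_{x\in\mathcal{X}}$ is a Markov kernel from $\mathcal{X}$ to $[0,1]$; its mean-payoff function is $f(x)=\int y\,dM_x(y)$, and $f^*=\sup_{x\in\mathcal{X}}f(x)$. Let $\mathcal{F}_{\mathcal{X},\ell}$ be the set of the environments that are weakly Lipschitz, that is, such that for all $x,y\in\mathcal{X}$, $$f^*-f(y)\ \le\ f^*-f(x)+\max\{f^*-f(x),\,\ell(x,y)\}.$$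 A bandit strategy $\varphi$ is a sequence of Markov kernels $\varphi_t$ from $(\mathcal{X}\times[0,1])^{t-1}$ to $\mathcal{X}$, $t\ge 1$: in round $t$ the arm $X_t$ is drawn from $\varphi_t(X_1,Y_1,\ldots,X_{t-1},Y_{t-1})$, and then, given $X_t$, the reward $Y_t$ is drawn from $M_{X_t}$ independently of the past. Let $\mathbb{E}_M[R_n(\varphi)]$ be the expectation of the cumulative regret $R_n=n f^*-\sum_{t=1}^n f(X_t)$. Then for every bandit strategy $\varphi$ and every integer $n\ge N(c,D)$, $$\sup_{M\in\mathcal{F}_{\mathcal{X},\ell}}\mathbb{E}_M\bigl[R_n(\varphi)\bigr]\ \ge\ \gamma(c,D)\,n^{(D+1)/(D+2)} .$$ -/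

import Mathlib

open MeasureTheory ProbabilityTheory
open scoped ENNReal unitInterval

noncomputable section

namespace XBandit

/-- The `ℓ`-open ball `{y | ℓ(x, y) < ε}` with centre `x` and radius `ε`. -/
def openBall {X : Type*} (ℓ : X → X → ℝ) (x : X) (ε : ℝ) : Set X :=
  {y | ℓ x y < ε}

/-- The `ε`-packing number of `X` with respect to `ℓ`: the supremum (possibly infinite) of the
integers `k` such that there are `k` pairwise disjoint `ℓ`-open balls of radius `ε` in `X`. -/
def packingNumber (X : Type*) (ℓ : X → X → ℝ) (ε : ℝ) : ℕ∞ :=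
  ⨆ (k : ℕ) (_ : ∃ x : Fin k → X,
    Pairwise fun i j => Disjoint (openBall ℓ (x i) ε) (openBall ℓ (x j) ε)), (k : ℕ∞)

/-- A bandit environment on `X`: to each arm corresponds a probability distribution of rewards
on `[0, 1]`, depending measurably on the arm. -/
structure Environment (X : Type*) [MeasurableSpace X] where
  reward : Kernel X I
  isMarkovKernel : IsMarkovKernel reward

/-- The mean payoff `f(x) = ∫ y dM_x(y)` of the arm `x`. -/
def Environment.meanPayoff {X : Type*} [MeasurableSpace X] (M : Environment X) (x : X) : ℝ :=
  ∫ y : I, (y : ℝ) ∂(M.reward x)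

/-- The best expected payoff `f* = sup_x f(x)`. -/
def Environment.bestPayoff {X : Type*} [MeasurableSpace X] (M : Environment X) : ℝ :=
  ⨆ x : X, M.meanPayoff x

/-- The mean-payoff function of `M` is weakly Lipschitz with respect to `ℓ`. -/
def Environment.WeaklyLipschitz {X : Type*} [MeasurableSpace X] (ℓ : X → X → ℝ)
    (M : Environment X) : Prop :=
  ∀ x y : X, M.bestPayoff - M.meanPayoff y ≤
    M.bestPayoff - M.meanPayoff x + max (M.bestPayoff - M.meanPayoff x) (ℓ x y)

/-- A (possibly randomized) bandit strategy: after `n` rounds with past observations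
`((X_1, Y_1), …, (X_n, Y_n))`, the next arm is drawn from a probability distribution on `X`
which depends measurably on these observations. -/
structure Strategy (X : Type*) [MeasurableSpace X] where
  select : (n : ℕ) → Kernel (Fin n → X × I) X
  isMarkovKernel : ∀ n, IsMarkovKernel (select n)

/-- Append the observation of a new round to a history. -/
def extend {X : Type*} (n : ℕ) (p : (Fin n → X × I) × (X × I)) : Fin (n + 1) → X × I :=
  Fin.snoc (α := fun _ => X × I) p.1 p.2

theorem measurable_extend {X : Type*} [MeasurableSpace X] (n : ℕ) :
    Measurable (extend (X := X) n) := by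
  refine measurable_pi_lambda _ fun i => ?_
  refine Fin.lastCases ?_ (fun j => ?_) i
  · simpa [extend] using measurable_snd
  · simpa [extend, Function.comp_def] using (measurable_pi_apply j).comp measurable_fst

/-- The distribution of the next observation `(X_{n+1}, Y_{n+1})` given the history:
`X_{n+1}` is drawn by the strategy, then `Y_{n+1}` is drawn from `M_{X_{n+1}}`. -/
def nextRound {X : Type*} [MeasurableSpace X] (φ : Strategy X) (M : Environment X) (n : ℕ) :
    Kernel (Fin n → X × I) (X × I) :=
  φ.select n ⊗ₖ Kernel.prodMkLeft (Fin n → X × I) M.reward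

/-- The joint distribution of `((X_1, Y_1), …, (X_n, Y_n))` when the strategy `φ` plays in the
environment `M`. -/
def historyLaw {X : Type*} [MeasurableSpace X] (φ : Strategy X) (M : Environment X) :
    (n : ℕ) → Measure (Fin n → X × I)
  | 0 => Measure.dirac Fin.elim0
  | n + 1 => (historyLaw φ M n ⊗ₘ nextRound φ M n).map (extend n)

instance {X : Type*} [MeasurableSpace X] (φ : Strategy X) (M : Environment X) (n : ℕ) :
    IsMarkovKernel (nextRound φ M n) := by
  have := φ.isMarkovKernel n
  have := M.isMarkovKernel
  unfold nextRound
  infer_instance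

instance {X : Type*} [MeasurableSpace X] (φ : Strategy X) (M : Environment X) (n : ℕ) :
    IsProbabilityMeasure (historyLaw φ M n) := by
  induction n with
  | zero => unfold historyLaw; infer_instance
  | succ n ih =>
    unfold historyLaw
    exact Measure.isProbabilityMeasure_map (measurable_extend n).aemeasurable

/-- The expected cumulative regret `E_M[R_n(φ)]`, where `R_n = n f* - ∑_{t ≤ n} f(X_t)`. -/
def expectedRegret {X : Type*} [MeasurableSpace X] (φ : Strategy X) (M : Environment X)
    (n : ℕ) : ℝ :=
  ∫ h, ((n : ℝ) * M.bestPayoff - ∑ t : Fin n, M.meanPayoff (h t).1) ∂(historyLaw φ M n)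

end XBandit

end

/-! Hide a small bump among many disjoint balls. Take `K` disjoint balls of radius `ε`. Environment
`i` pays a Bernoulli reward of mean `1/2` plus a tent of height `ε` supported on ball `i`; the tent
is 1-Lipschitz, so the environment is admissible, and each pull outside ball `i` costs `ε`.

Under fair coin flips the expected pulls of the balls sum to at most `n`, so some ball receives at
most `n / K` of them. Passing from the fair environment to the one with a bump there has divergence
at most `3 ε² n / K`, so while `n ε²` is small compared with `K` the bump goes mostly unnoticed:
that ball is pulled at most `5n/8` times on average (`integral_pullCount_le`,
`exists_integral_pullCount_le`), and the regret is at least `3nε/8`. As `K ≥ c ε^(-D)`, the choice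
`ε ≍ n^(-1/(D+2))` is allowed and gives the rate. -/

noncomputable section

namespace XBandit

variable {X : Type*} [MeasurableSpace X]

/-! ### Bernoulli environments and their densities with respect to fair coins. -/

/-- The law on `[0, 1]` of a Bernoulli variable of parameter `1 / 2 + b`. -/
def bernoulliLaw (b : ℝ) : Measure I :=
  ENNReal.ofReal (1 / 2 + b) • Measure.dirac 1 + ENNReal.ofReal (1 / 2 - b) • Measure.dirac 0

theorem lintegral_bernoulliLaw (b : ℝ) (g : I → ℝ≥0∞) (hg : Measurable g) :
    ∫⁻ y, g y ∂(bernoulliLaw b) =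
      ENNReal.ofReal (1 / 2 + b) * g 1 + ENNReal.ofReal (1 / 2 - b) * g 0 := by
  simp only [bernoulliLaw]
  rw [lintegral_add_measure, lintegral_smul_measure, lintegral_smul_measure,
    lintegral_dirac' _ hg, lintegral_dirac' _ hg]
  simp

theorem integral_bernoulliLaw {b : ℝ} (hb : |b| ≤ 1 / 4) (g : I → ℝ) :
    ∫ y, g y ∂(bernoulliLaw b) = (1 / 2 + b) * g 1 + (1 / 2 - b) * g 0 := by
  have := abs_le.1 hb
  have hi (z : I) : Integrable g (Measure.dirac z) := integrable_dirac (by simp)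
  unfold bernoulliLaw
  rw [integral_add_measure ((hi 1).smul_measure ENNReal.ofReal_ne_top)
    ((hi 0).smul_measure ENNReal.ofReal_ne_top), integral_smul_measure, integral_smul_measure,
    integral_dirac, integral_dirac, ENNReal.toReal_ofReal (by linarith),
    ENNReal.toReal_ofReal (by linarith)]
  simp

/-- The environment in which the arm `x` has a Bernoulli reward of parameter `1 / 2 + b x`. -/
def bernoulliEnv (b : X → ℝ) (hm : Measurable b) (hb : ∀ x, |b x| ≤ 1 / 4) : Environment X where
  reward :=
    { toFun := fun x => bernoulliLaw (b x)
      measurable' := by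
        refine Measure.measurable_of_measurable_coe _ fun s _ => ?_
        simp only [bernoulliLaw, Measure.add_apply, Measure.smul_apply, smul_eq_mul]
        fun_prop }
  isMarkovKernel := ⟨fun x => ⟨by
    have := abs_le.1 (hb x)
    change bernoulliLaw (b x) Set.univ = 1
    simp only [bernoulliLaw, Measure.add_apply, Measure.smul_apply, smul_eq_mul, measure_univ,
      mul_one]
    rw [← ENNReal.ofReal_add (by linarith) (by linarith)]
    norm_num⟩⟩

theorem bernoulliEnv_reward (b : X → ℝ) (hm : Measurable b) (hb : ∀ x, |b x| ≤ 1 / 4) (x : X) :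
    (bernoulliEnv b hm hb).reward x = bernoulliLaw (b x) := rfl

theorem meanPayoff_bernoulliEnv (b : X → ℝ) (hm : Measurable b) (hb : ∀ x, |b x| ≤ 1 / 4)
    (x : X) : (bernoulliEnv b hm hb).meanPayoff x = 1 / 2 + b x := by
  unfold Environment.meanPayoff
  rw [bernoulliEnv_reward, integral_bernoulliLaw (hb x)]
  simp

/-- The density of `bernoulliLaw (b x)` with respect to `bernoulliLaw 0`. -/
def rewardRatio (b : X → ℝ) (p : X × I) : ℝ :=
  1 + 2 * b p.1 * (2 * (p.2 : ℝ) - 1)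

theorem measurable_rewardRatio {b : X → ℝ} (hm : Measurable b) : Measurable (rewardRatio b) := by
  unfold rewardRatio
  fun_prop

/-- Staying away from `0` and `∞` makes likelihoods and their logarithms bounded, which settles
their integrability. -/
theorem rewardRatio_mem {X : Type*} {b : X → ℝ} (hb : ∀ x, |b x| ≤ 1 / 4) (p : X × I) :
    1 / 2 ≤ rewardRatio b p ∧ rewardRatio b p ≤ 3 / 2 := by
  have h1 : |2 * (p.2 : ℝ) - 1| ≤ 1 := by
    have := p.2.2.1
    have := p.2.2.2
    rw [abs_le]
    constructor <;> linarith
  have h2 : |b p.1 * (2 * (p.2 : ℝ) - 1)| ≤ 1 / 4 := by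
    rw [abs_mul]
    nlinarith [hb p.1, abs_nonneg (b p.1), abs_nonneg (2 * (p.2 : ℝ) - 1)]
  have := abs_le.1 h2
  unfold rewardRatio
  constructor <;> nlinarith

theorem lintegral_bernoulliLaw_eq_ratio {X : Type*} {b : X → ℝ} (hb : ∀ x, |b x| ≤ 1 / 4) (x : X)
    (g : I → ℝ≥0∞) (hg : Measurable g) :
    ∫⁻ y, g y ∂(bernoulliLaw (b x)) =
      ∫⁻ y, ENNReal.ofReal (rewardRatio b (x, y)) * g y ∂(bernoulliLaw 0) := by
  have := abs_le.1 (hb x)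
  rw [lintegral_bernoulliLaw _ _ hg, lintegral_bernoulliLaw]
  · rw [← mul_assoc, ← mul_assoc, ← ENNReal.ofReal_mul (by norm_num),
      ← ENNReal.ofReal_mul (by norm_num)]
    simp only [rewardRatio, Set.Icc.coe_one, Set.Icc.coe_zero]
    congr 3 <;> ring
  · have : Measurable fun y : I => rewardRatio b (x, y) := by
      simp only [rewardRatio]
      fun_prop
    exact this.ennreal_ofReal.mul hg

/-! ### Laws of histories and change of measure. -/

theorem lintegral_historyLaw_succ (φ : Strategy X) (M : Environment X) (n : ℕ)
    (g : (Fin (n + 1) → X × I) → ℝ≥0∞) (hg : Measurable g) :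
    ∫⁻ h, g h ∂(historyLaw φ M (n + 1)) =
      ∫⁻ h, ∫⁻ x, ∫⁻ y, g (extend n (h, (x, y))) ∂(M.reward x) ∂(φ.select n h)
        ∂(historyLaw φ M n) := by
  have := φ.isMarkovKernel n
  have := M.isMarkovKernel
  have hge : Measurable fun p => g (extend (X := X) n p) := hg.comp (measurable_extend n)
  rw [historyLaw, lintegral_map hg (measurable_extend n), Measure.lintegral_compProd hge]
  refine lintegral_congr fun h => ?_
  exact Kernel.lintegral_compProd _ _ _ (hge.comp measurable_prodMk_left)

theorem integral_historyLaw_succ (φ : Strategy X) (M : Environment X) (n : ℕ)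
    (g : (Fin (n + 1) → X × I) → ℝ) (hg : Measurable g) {C : ℝ} (hC : ∀ h, |g h| ≤ C) :
    ∫ h, g h ∂(historyLaw φ M (n + 1)) =
      ∫ h, ∫ x, ∫ y, g (extend n (h, (x, y))) ∂(M.reward x) ∂(φ.select n h)
        ∂(historyLaw φ M n) := by
  have := φ.isMarkovKernel n
  have := M.isMarkovKernel
  have hge : Measurable fun p => g (extend (X := X) n p) := hg.comp (measurable_extend n)
  rw [historyLaw, integral_map (measurable_extend n).aemeasurable hg.aestronglyMeasurable,
    Measure.integral_compProd (.of_bound hge.aestronglyMeasurable C (.of_forall fun _ => hC _))]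
  refine integral_congr_ae (.of_forall fun h => ?_)
  exact integral_compProd (.of_bound
    (hge.comp measurable_prodMk_left).aestronglyMeasurable C (.of_forall fun _ => hC _))

/-- The likelihood ratio of a history. -/
def likelihood (b : X → ℝ) (n : ℕ) (h : Fin n → X × I) : ℝ :=
  ∏ t, rewardRatio b (h t)

theorem measurable_likelihood {b : X → ℝ} (hm : Measurable b) (n : ℕ) :
    Measurable (likelihood b n) := by
  have := measurable_rewardRatio hm
  unfold likelihood
  fun_prop

theorem likelihood_pos {X : Type*} {b : X → ℝ} (hb : ∀ x, |b x| ≤ 1 / 4) (n : ℕ) (h : Fin n → X × I) :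
    0 < likelihood b n h :=
  Finset.prod_pos fun t _ => by linarith [(rewardRatio_mem hb (h t)).1]

theorem likelihood_le {X : Type*} {b : X → ℝ} (hb : ∀ x, |b x| ≤ 1 / 4) (n : ℕ) (h : Fin n → X × I) :
    likelihood b n h ≤ (3 / 2) ^ n := by
  refine (Finset.prod_le_prod (g := fun _ => (3 / 2 : ℝ)) (fun t _ => ?_) fun t _ => ?_).trans
    (by simp [div_pow])
  · linarith [(rewardRatio_mem hb (h t)).1]
  · exact (rewardRatio_mem hb (h t)).2

theorem likelihood_extend {X : Type*} (b : X → ℝ) (n : ℕ) (h : Fin n → X × I) (p : X × I) :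
    likelihood b (n + 1) (extend n (h, p)) = likelihood b n h * rewardRatio b p := by
  simp [likelihood, extend, Fin.prod_univ_castSucc]

/-- The environment in which all rewards are fair coin flips. -/
def fairEnv (X : Type*) [MeasurableSpace X] : Environment X :=
  bernoulliEnv (fun _ => 0) measurable_const (by simp)

theorem fairEnv_reward (x : X) : (fairEnv X).reward x = bernoulliLaw 0 := rfl

/-- Both environments face the same strategy kernels, so only the reward densities enter the ratio.
The induction applies to `g` with its last round integrated out. -/
theorem lintegral_historyLaw_bernoulliEnv (φ : Strategy X) {b : X → ℝ} (hm : Measurable b)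
    (hb : ∀ x, |b x| ≤ 1 / 4) (n : ℕ) (g : (Fin n → X × I) → ℝ≥0∞) (hg : Measurable g) :
    ∫⁻ h, g h ∂(historyLaw φ (bernoulliEnv b hm hb) n) =
      ∫⁻ h, ENNReal.ofReal (likelihood b n h) * g h ∂(historyLaw φ (fairEnv X) n) := by
  induction n with
  | zero => simp [historyLaw, likelihood]
  | succ n ih =>
    have := φ.isMarkovKernel n
    have := (bernoulliEnv b hm hb).isMarkovKernel
    have := (fairEnv X).isMarkovKernel
    have hL := measurable_likelihood hm
    have hge : Measurable fun p => g (extend (X := X) n p) := hg.comp (measurable_extend n)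
    have hgM : Measurable fun h : Fin n → X × I => ∫⁻ p, g (extend n (h, p))
        ∂(nextRound φ (bernoulliEnv b hm hb) n h) := hge.lintegral_kernel_prod_right'
    have hg3 : Measurable fun h : Fin n → X × I => ∫⁻ x, ∫⁻ y, g (extend n (h, (x, y)))
        ∂((bernoulliEnv b hm hb).reward x) ∂(φ.select n h) := by
      convert hgM using 2 with h
      exact (Kernel.lintegral_compProd (φ.select n)
        (Kernel.prodMkLeft (Fin n → X × I) (bernoulliEnv b hm hb).reward) h
        (hge.comp measurable_prodMk_left)).symm
    have hLg : Measurable fun h => ENNReal.ofReal (likelihood b (n + 1) h) * g h :=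
      (hL _).ennreal_ofReal.mul hg
    rw [lintegral_historyLaw_succ _ _ _ _ hg, ih _ hg3, lintegral_historyLaw_succ _ _ _ _ hLg]
    refine lintegral_congr fun h => ?_
    have key (x : X) : ∫⁻ y, ENNReal.ofReal (likelihood b (n + 1) (extend n (h, (x, y)))) *
          g (extend n (h, (x, y))) ∂((fairEnv X).reward x) =
        ENNReal.ofReal (likelihood b n h) *
          ∫⁻ y, g (extend n (h, (x, y))) ∂((bernoulliEnv b hm hb).reward x) := by
      have hgy : Measurable fun y : I => g (extend n (h, (x, y))) :=
        hge.comp (measurable_prodMk_left.comp measurable_prodMk_left)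
      rw [bernoulliEnv_reward, lintegral_bernoulliLaw_eq_ratio hb x _ hgy, fairEnv_reward,
        ← lintegral_const_mul' _ _ ENNReal.ofReal_ne_top]
      refine lintegral_congr fun y => ?_
      rw [likelihood_extend, ENNReal.ofReal_mul (likelihood_pos hb n h).le, mul_assoc]
    simp only [key]
    rw [lintegral_const_mul']
    exact ENNReal.ofReal_ne_top

theorem historyLaw_bernoulliEnv_eq_withDensity (φ : Strategy X) {b : X → ℝ} (hm : Measurable b)
    (hb : ∀ x, |b x| ≤ 1 / 4) (n : ℕ) :
    historyLaw φ (bernoulliEnv b hm hb) n =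
      (historyLaw φ (fairEnv X) n).withDensity fun h => ENNReal.ofReal (likelihood b n h) := by
  ext s hs
  have := lintegral_historyLaw_bernoulliEnv φ hm hb n (s.indicator 1)
    (measurable_one.indicator hs)
  rw [lintegral_indicator_one hs] at this
  rw [this, withDensity_apply _ hs, ← lintegral_indicator hs]
  refine lintegral_congr fun h => ?_
  by_cases hh : h ∈ s <;> simp [hh]

theorem integral_historyLaw_bernoulliEnv (φ : Strategy X) {b : X → ℝ} (hm : Measurable b)
    (hb : ∀ x, |b x| ≤ 1 / 4) (n : ℕ) (g : (Fin n → X × I) → ℝ) :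
    ∫ h, g h ∂(historyLaw φ (bernoulliEnv b hm hb) n) =
      ∫ h, likelihood b n h * g h ∂(historyLaw φ (fairEnv X) n) := by
  rw [historyLaw_bernoulliEnv_eq_withDensity, integral_withDensity_eq_integral_toReal_smul
    (measurable_likelihood hm n).ennreal_ofReal (by simp)]
  refine integral_congr_ae (.of_forall fun h => ?_)
  simp [ENNReal.toReal_ofReal (likelihood_pos hb n h).le]

/-! ### Cumulative sums, divergence and pull counts. -/

theorem abs_sum_le_of_abs_le {α : Type*} {g : α → ℝ} {C : ℝ} (hC : ∀ p, |g p| ≤ C) (n : ℕ)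
    (h : Fin n → α) : |∑ t, g (h t)| ≤ n * C := by
  refine (Finset.abs_sum_le_sum_abs _ _).trans ?_
  refine (Finset.sum_le_sum fun t _ => hC (h t)).trans ?_
  simp

theorem integrable_sum_of_abs_le {α : Type*} [MeasurableSpace α] {g : α → ℝ} (hg : Measurable g)
    {C : ℝ} (hC : ∀ p, |g p| ≤ C) (n : ℕ) (μ : Measure (Fin n → α)) [IsFiniteMeasure μ] :
    Integrable (fun h => ∑ t, g (h t)) μ :=
  .of_bound (Measurable.aestronglyMeasurable (by fun_prop)) (n * C)
    (.of_forall fun h => abs_sum_le_of_abs_le hC n h)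

/-- If, for each arm, the conditional expectation of `g` given the arm is at most that of `g'`,
then the same holds for the cumulated values along a history. -/
theorem integral_sum_historyLaw_le (φ : Strategy X) (M : Environment X) {g g' : X × I → ℝ}
    (hg : Measurable g) (hg' : Measurable g') {C : ℝ} (hC : ∀ p, |g p| ≤ C)
    (hC' : ∀ p, |g' p| ≤ C)
    (hle : ∀ x, ∫ y, g (x, y) ∂(M.reward x) ≤ ∫ y, g' (x, y) ∂(M.reward x)) (n : ℕ) :
    ∫ h, ∑ t, g (h t) ∂(historyLaw φ M n) ≤ ∫ h, ∑ t, g' (h t) ∂(historyLaw φ M n) := by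
  induction n with
  | zero => simp
  | succ n ih =>
    have := φ.isMarkovKernel n
    have := M.isMarkovKernel
    have step {k : X × I → ℝ} (hk : Measurable k) (hkC : ∀ p, |k p| ≤ C) :
        ∫ h, ∑ t, k (h t) ∂(historyLaw φ M (n + 1)) =
          ∫ h, ∑ t, k (h t) ∂(historyLaw φ M n) +
          ∫ h, ∫ x, ∫ y, k (x, y) ∂(M.reward x) ∂(φ.select n h) ∂(historyLaw φ M n) ∧
        Integrable (fun h => ∫ x, ∫ y, k (x, y) ∂(M.reward x) ∂(φ.select n h))
          (historyLaw φ M n) ∧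
        ∀ h, Integrable (fun x => ∫ y, k (x, y) ∂(M.reward x)) (φ.select n h) := by
      have hm1 : StronglyMeasurable fun x => ∫ y, k (x, y) ∂(M.reward x) :=
        hk.stronglyMeasurable.integral_kernel_prod_right'
      have hb1 (x : X) : ‖∫ y, k (x, y) ∂(M.reward x)‖ ≤ C := by
        simpa using norm_integral_le_of_norm_le_const (μ := M.reward x)
          (f := fun y => k (x, y)) (C := C) (.of_forall fun y => hkC (x, y))
      have hi1 (h : Fin n → X × I) :
          Integrable (fun x => ∫ y, k (x, y) ∂(M.reward x)) (φ.select n h) :=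
        .of_bound hm1.aestronglyMeasurable C (.of_forall hb1)
      have hm2 : StronglyMeasurable
          fun h => ∫ x, ∫ y, k (x, y) ∂(M.reward x) ∂(φ.select n h) :=
        hm1.integral_kernel
      have hi2 : Integrable (fun h => ∫ x, ∫ y, k (x, y) ∂(M.reward x) ∂(φ.select n h))
          (historyLaw φ M n) := by
        refine .of_bound hm2.aestronglyMeasurable C (.of_forall fun h => ?_)
        simpa using norm_integral_le_of_norm_le_const (μ := φ.select n h) (.of_forall hb1)
      refine ⟨?_, hi2, hi1⟩
      rw [integral_historyLaw_succ φ M n _ (by fun_prop) (abs_sum_le_of_abs_le hkC _),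
        ← integral_add (integrable_sum_of_abs_le hk hkC n _) hi2]
      refine integral_congr_ae (.of_forall fun h => ?_)
      have e (x : X) : ∫ y, ∑ t, k (extend n (h, (x, y)) t) ∂(M.reward x) =
          ∑ t, k (h t) + ∫ y, k (x, y) ∂(M.reward x) := by
        simp only [extend, Fin.sum_univ_castSucc, Fin.snoc_castSucc, Fin.snoc_last]
        have hi : Integrable (fun y => k (x, y)) (M.reward x) := .of_bound
          (hk.comp measurable_prodMk_left).aestronglyMeasurable C (.of_forall fun _ => hkC _)
        rw [integral_add (integrable_const _) hi]
        simp
      simp only [e]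
      rw [integral_add (integrable_const _) (hi1 h)]
      simp
    obtain ⟨e, hi, hi1⟩ := step hg hC
    obtain ⟨e', hi', hi1'⟩ := step hg' hC'
    rw [e, e']
    exact add_le_add ih (integral_mono hi hi' fun h => integral_mono (hi1 h) (hi1' h) hle)

theorem abs_log_rewardRatio_le {X : Type*} {b : X → ℝ} (hb : ∀ x, |b x| ≤ 1 / 4) (p : X × I) :
    |-Real.log (rewardRatio b p)| ≤ 1 := by
  obtain ⟨h1, h2⟩ := rewardRatio_mem hb p
  have h3 := Real.log_le_sub_one_of_pos (show 0 < rewardRatio b p by linarith)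
  have h4 := Real.one_sub_inv_le_log_of_pos (show 0 < rewardRatio b p by linarith)
  have h5 : (rewardRatio b p)⁻¹ ≤ 2 := by
    rw [inv_le_comm₀ (by linarith) (by norm_num)]
    linarith
  rw [abs_le]
  constructor <;> linarith

/-- The Kullback–Leibler divergence of a Bernoulli law with respect to a fair coin flip is at most
quadratic in the difference of the parameters. -/
theorem integral_neg_log_rewardRatio_le {X : Type*} {b : X → ℝ} (hb : ∀ x, |b x| ≤ 1 / 4) (x : X) :
    ∫ y, -Real.log (rewardRatio b (x, y)) ∂(bernoulliLaw 0) ≤ 3 * b x ^ 2 := by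
  have hx := abs_le.1 (hb x)
  have hsq : b x ^ 2 ≤ 1 / 16 := by nlinarith
  have hpos : 0 < 1 - 4 * b x ^ 2 := by linarith
  -- The integral equals `-(1/2) log (1 - 4 b²)`, and `log u ≥ 1 - u⁻¹` bounds it by `3 b²` once `b²
  -- ≤ 1/16`.
  have e : Real.log (1 - 4 * b x ^ 2) = Real.log (1 + 2 * b x) + Real.log (1 - 2 * b x) := by
    rw [← Real.log_mul (by linarith) (by linarith)]
    ring_nf
  have h4 := Real.one_sub_inv_le_log_of_pos hpos
  have h5 : (1 - 4 * b x ^ 2)⁻¹ ≤ 1 + 6 * b x ^ 2 := by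
    rw [inv_le_iff_one_le_mul₀ hpos]
    nlinarith [sq_nonneg (b x)]
  rw [integral_bernoulliLaw (by simp)]
  simp only [rewardRatio, Set.Icc.coe_one, Set.Icc.coe_zero]
  ring_nf at e h4 h5 ⊢
  linarith

/-- A pointwise, linearised Pinsker inequality: for a likelihood ratio `L` of mean 1, integration
gives `E|L - 1| ≤ KL / (2a) + 2a`. With `s = √L`, apply AM-GM of weight `a` to `|s - 1| (s + 1)`;
then `log s ≤ s - 1` gives `(s - 1)² ≤ L - 1 - log L`. -/
theorem abs_sub_one_le {L a : ℝ} (hL : 0 < L) (ha : 0 < a) :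
    |L - 1| ≤ (L - 1 - Real.log L) / (2 * a) + a * (1 + L) := by
  obtain ⟨s, hs, rfl⟩ : ∃ s : ℝ, 0 < s ∧ L = s ^ 2 :=
    ⟨√L, Real.sqrt_pos.2 hL, (Real.sq_sqrt hL.le).symm⟩
  have hlog : Real.log (s ^ 2) ≤ 2 * (s - 1) := by
    rw [Real.log_pow]
    have := Real.log_le_sub_one_of_pos hs
    push_cast
    linarith
  have h1 : |s ^ 2 - 1| = |s - 1| * (s + 1) := by
    rw [show s ^ 2 - 1 = (s - 1) * (s + 1) by ring, abs_mul, abs_of_pos (by linarith : 0 < s + 1)]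
  have h2 : (s - 1) ^ 2 / (2 * a) ≤ (s ^ 2 - 1 - Real.log (s ^ 2)) / (2 * a) := by
    gcongr
    nlinarith
  have h3 : |s - 1| * (s + 1) ≤ (s - 1) ^ 2 / (2 * a) + a / 2 * (s + 1) ^ 2 := by
    rw [← sq_abs (s - 1), div_add' _ _ _ (by positivity), le_div_iff₀ (by positivity)]
    nlinarith [sq_nonneg (|s - 1| - a * (s + 1))]
  have h4 : a / 2 * (s + 1) ^ 2 ≤ a * (1 + s ^ 2) := by
    nlinarith [mul_nonneg ha.le (sq_nonneg (s - 1))]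
  rw [h1]
  linarith

/-- The number of rounds in which the chosen arm belongs to `B`. -/
def pullCount (B : Set X) (n : ℕ) (h : Fin n → X × I) : ℝ :=
  ∑ t, B.indicator 1 (h t).1

theorem pullCount_nonneg {X : Type*} (B : Set X) (n : ℕ) (h : Fin n → X × I) : 0 ≤ pullCount B n h :=
  Finset.sum_nonneg fun _ _ => Set.indicator_nonneg (by simp) _

theorem abs_indicator_one_le {α : Type*} (B : Set α) (x : α) :
    |B.indicator (1 : α → ℝ) x| ≤ 1 := by
  by_cases hx : x ∈ B <;> simp [hx]

theorem pullCount_le {X : Type*} (B : Set X) (n : ℕ) (h : Fin n → X × I) : pullCount B n h ≤ n := by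
  have := abs_sum_le_of_abs_le (g := fun p : X × I => B.indicator (1 : X → ℝ) p.1)
    (fun p => abs_indicator_one_le B p.1) n h
  rw [mul_one] at this
  exact (le_abs_self _).trans this

theorem measurable_indicator_fst {B : Set X} (hB : MeasurableSet B) :
    Measurable fun p : X × I => B.indicator (1 : X → ℝ) p.1 :=
  (measurable_one.indicator hB).comp measurable_fst

theorem measurable_pullCount {B : Set X} (hB : MeasurableSet B) (n : ℕ) :
    Measurable (pullCount B n) :=
  Finset.measurable_fun_sum _ fun t _ => (measurable_indicator_fst hB).comp (measurable_pi_apply t)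

theorem integrable_pullCount {B : Set X} (hB : MeasurableSet B) (n : ℕ)
    (μ : Measure (Fin n → X × I)) [IsFiniteMeasure μ] : Integrable (pullCount B n) μ :=
  integrable_sum_of_abs_le (measurable_indicator_fst hB)
    (fun p => abs_indicator_one_le B p.1) n μ

/-- The chain rule for the divergence of the fair law from the bumped one: a round contributes at
most `3 ε²`, and only if its arm lies in `B`. In this direction the pulls are counted under the fair
law, which does not depend on the bump. -/
theorem integral_neg_log_likelihood_le (φ : Strategy X) {b : X → ℝ} (hm : Measurable b) {ε : ℝ}
    {B : Set X} (hB : MeasurableSet B) (hb : ∀ x, |b x| ≤ 1 / 4)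
    (hbε : ∀ x, |b x| ≤ B.indicator (fun _ => ε) x) (n : ℕ) :
    ∫ h, -Real.log (likelihood b n h) ∂(historyLaw φ (fairEnv X) n) ≤
      3 * ε ^ 2 * ∫ h, pullCount B n h ∂(historyLaw φ (fairEnv X) n) := by
  have hr := measurable_rewardRatio hm
  have hi := measurable_indicator_fst hB
  have hb2 (x : X) : b x ^ 2 ≤ ε ^ 2 * B.indicator (1 : X → ℝ) x := by
    have := hbε x
    rw [← sq_abs]
    by_cases hx : x ∈ B
    · simp only [hx, Set.indicator_of_mem, Pi.one_apply, mul_one] at this ⊢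
      gcongr
    · simp only [hx, not_false_eq_true, Set.indicator_of_notMem] at this ⊢
      simp [abs_nonpos_iff.1 this]
  have key := integral_sum_historyLaw_le φ (fairEnv X)
    (g := fun p => -Real.log (rewardRatio b p))
    (g' := fun p => 3 * ε ^ 2 * B.indicator (1 : X → ℝ) p.1) (by fun_prop)
    (hi.const_mul _) (C := max 1 (3 * ε ^ 2)) (fun p => (abs_log_rewardRatio_le hb p).trans
      (le_max_left _ _)) (fun p => ?_) (fun x => ?_) n
  · convert key using 1
    · refine integral_congr_ae (.of_forall fun h => ?_)
      simp only [likelihood]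
      rw [Real.log_prod fun t _ => ?_, Finset.sum_neg_distrib]
      linarith [(rewardRatio_mem hb (h t)).1]
    · simp only [← Finset.mul_sum]
      rw [integral_const_mul]
      rfl
  · rw [abs_mul, abs_of_nonneg (by positivity : 0 ≤ 3 * ε ^ 2)]
    refine le_trans ?_ (le_max_right _ _)
    exact mul_le_of_le_one_right (by positivity) (abs_indicator_one_le B p.1)
  · rw [fairEnv_reward]
    refine (integral_neg_log_rewardRatio_le hb x).trans ?_
    rw [integral_bernoulliLaw (by simp)]
    linarith [hb2 x]

theorem integrable_likelihood (φ : Strategy X) {b : X → ℝ} (hm : Measurable b)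
    (hb : ∀ x, |b x| ≤ 1 / 4) (n : ℕ) :
    Integrable (likelihood b n) (historyLaw φ (fairEnv X) n) :=
  .of_bound (measurable_likelihood hm n).aestronglyMeasurable ((3 / 2) ^ n)
    (.of_forall fun h => by
      rw [Real.norm_eq_abs, abs_of_pos (likelihood_pos hb n h)]
      exact likelihood_le hb n h)

theorem integral_likelihood (φ : Strategy X) {b : X → ℝ} (hm : Measurable b)
    (hb : ∀ x, |b x| ≤ 1 / 4) (n : ℕ) :
    ∫ h, likelihood b n h ∂(historyLaw φ (fairEnv X) n) = 1 := by
  simpa using (integral_historyLaw_bernoulliEnv φ hm hb n fun _ => 1).symm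

theorem integrable_neg_log_likelihood (φ : Strategy X) {b : X → ℝ} (hm : Measurable b)
    (hb : ∀ x, |b x| ≤ 1 / 4) (n : ℕ) :
    Integrable (fun h => -Real.log (likelihood b n h)) (historyLaw φ (fairEnv X) n) := by
  have hr := measurable_rewardRatio hm
  convert integrable_sum_of_abs_le (g := fun p => -Real.log (rewardRatio b p)) (by fun_prop)
    (abs_log_rewardRatio_le hb) n (historyLaw φ (fairEnv X) n) using 2 with h
  simp only [likelihood]
  rw [Real.log_prod fun t _ => ?_, Finset.sum_neg_distrib]
  linarith [(rewardRatio_mem hb (h t)).1]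

/-- Change of measure: raising the rewards on `B` by at most `ε` does not increase much the expected
number of pulls in `B` when it is small under the fair environment. -/
theorem integral_pullCount_le (φ : Strategy X) {b : X → ℝ} (hm : Measurable b) {ε : ℝ}
    {B : Set X} (hB : MeasurableSet B) (hb : ∀ x, |b x| ≤ 1 / 4)
    (hbε : ∀ x, |b x| ≤ B.indicator (fun _ => ε) x) (n : ℕ) {a : ℝ} (ha : 0 < a) :
    ∫ h, pullCount B n h ∂(historyLaw φ (bernoulliEnv b hm hb) n) ≤
      ∫ h, pullCount B n h ∂(historyLaw φ (fairEnv X) n) +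
      n * (3 * ε ^ 2 * (∫ h, pullCount B n h ∂(historyLaw φ (fairEnv X) n)) / (2 * a) + 2 * a) := by
  set P := historyLaw φ (fairEnv X) n
  have hT := integrable_pullCount hB n P
  have hL := integrable_likelihood φ hm hb n
  have hl := integrable_neg_log_likelihood φ hm hb n
  have hLT : Integrable (fun h => likelihood b n h * pullCount B n h) P := by
    refine hL.mul_bdd (c := n) (measurable_pullCount hB n).aestronglyMeasurable
      (.of_forall fun h => ?_)
    rw [Real.norm_eq_abs, abs_of_nonneg (pullCount_nonneg B n h)]
    exact pullCount_le B n h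
  -- As `0 ≤ pullCount ≤ n`, reweighting by `L` adds at most `n |L - 1|`.
  have hpt (h : Fin n → X × I) : likelihood b n h * pullCount B n h ≤ pullCount B n h +
      n * ((likelihood b n h - 1 + -Real.log (likelihood b n h)) / (2 * a) +
        a * (1 + likelihood b n h)) := by
    have h1 := abs_sub_one_le (likelihood_pos hb n h) ha
    have h2 : (likelihood b n h - 1) * pullCount B n h ≤ |likelihood b n h - 1| * n :=
      mul_le_mul (le_abs_self _) (pullCount_le B n h) (pullCount_nonneg B n h) (abs_nonneg _)
    have h3 := mul_le_mul_of_nonneg_left h1 (Nat.cast_nonneg (α := ℝ) n)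
    rw [sub_eq_add_neg (likelihood b n h - 1)] at h3
    linarith
  rw [integral_historyLaw_bernoulliEnv]
  have i1 : Integrable (fun h => (likelihood b n h - 1 + -Real.log (likelihood b n h)) / (2 * a))
      P := ((hL.sub (integrable_const 1)).add hl).div_const _
  have i2 : Integrable (fun h => a * (1 + likelihood b n h)) P :=
    ((integrable_const 1).add hL).const_mul a
  have key := integral_mono hLT (hT.add ((i1.add i2).const_mul n)) hpt
  simp only [Pi.add_apply] at key
  rw [integral_add hT (.const_mul (f := fun h => (likelihood b n h - 1 +
      -Real.log (likelihood b n h)) / (2 * a) + a * (1 + likelihood b n h)) (i1.add i2) _),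
    integral_const_mul, integral_add i1 i2,
    integral_div,
    integral_add (f := fun h => likelihood b n h - 1) (hL.sub (integrable_const 1)) hl,
    integral_sub hL (integrable_const 1), integral_const_mul,
    integral_add (integrable_const 1) hL, integral_likelihood φ hm hb n] at key
  simp only [integral_const, probReal_univ, smul_eq_mul, mul_one, sub_self, zero_add] at key
  have h5 := integral_neg_log_likelihood_le φ hm hB hb hbε n
  refine key.trans ?_
  have h6 : a * (1 + 1) = 2 * a := by ring
  rw [h6]
  gcongr

/-! ### Choice of a rarely pulled region. -/

/-- Among finitely many disjoint regions, some region supporting a good bump makes the regret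
large. -/
theorem exists_integral_pullCount_le (φ : Strategy X) {K : ℕ} (hK : 2 ≤ K) {ε : ℝ}
    {B : Fin K → Set X} (hB : ∀ i, MeasurableSet (B i))
    (hd : Pairwise fun i j => Disjoint (B i) (B j)) {b : Fin K → X → ℝ}
    (hm : ∀ i, Measurable (b i)) (hb : ∀ i x, |b i x| ≤ 1 / 4)
    (hbε : ∀ i x, |b i x| ≤ (B i).indicator (fun _ => ε) x) (n : ℕ)
    (hn : 768 * (n * ε ^ 2) ≤ K) :
    ∃ i, ∫ h, pullCount (B i) n h ∂(historyLaw φ (bernoulliEnv (b i) (hm i) (hb i)) n) ≤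
      5 / 8 * n := by
  set P := historyLaw φ (fairEnv X) n
  have hsum : ∑ i, ∫ h, pullCount (B i) n h ∂P ≤ n := by
    rw [← integral_finsetSum _ fun i _ => integrable_pullCount (hB i) n P]
    refine (integral_mono (g := fun _ => (n : ℝ))
      (integrable_finsetSum _ fun i _ => integrable_pullCount (hB i) n P)
      (integrable_const _) fun h => ?_).trans (by simp)
    simp only [pullCount]
    rw [Finset.sum_comm]
    have h1 (t : Fin n) : ∑ i, (B i).indicator (1 : X → ℝ) (h t).1 ≤ 1 := by
      by_cases hx : ∃ i, (h t).1 ∈ B i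
      · obtain ⟨i, hi⟩ := hx
        rw [Finset.sum_eq_single i]
        · simp [hi]
        · intro j _ hj
          exact Set.indicator_of_notMem (fun hx => Set.disjoint_left.1 (hd hj) hx hi) _
        · simp
      · push Not at hx
        simp [hx]
    refine (Finset.sum_le_sum fun t _ => h1 t).trans (by simp)
  have hK0 : (2 : ℝ) ≤ K := by exact_mod_cast hK
  have : NeZero K := ⟨by omega⟩
  have havg : ∃ i, ∫ h, pullCount (B i) n h ∂P ≤ n / K := by
    by_contra! hcon
    have := Finset.sum_lt_sum_of_nonempty (s := (Finset.univ : Finset (Fin K)))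
      Finset.univ_nonempty fun i _ => hcon i
    simp only [Finset.sum_const, Finset.card_univ, Fintype.card_fin, nsmul_eq_mul] at this
    rw [mul_div_cancel₀ _ (by positivity)] at this
    linarith
  obtain ⟨i, hi⟩ := havg
  refine ⟨i, ?_⟩
  -- With `a = 1/32` the divergence term is at most `48 / 768 = 1/16` and `2a = 1/16`. Adding `n / K
  -- ≤ n / 2` gives `n/2 + n/8 = 5n/8`.
  have key := integral_pullCount_le φ (hm i) (hB i) (hb i) (hbε i) n
    (show (0 : ℝ) < 1 / 32 by norm_num)
  have h1 : (n : ℝ) / K ≤ n / 2 := by gcongr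
  have h2 : ε ^ 2 * ∫ h, pullCount (B i) n h ∂P ≤ 1 / 768 := by
    refine (mul_le_mul_of_nonneg_left hi (sq_nonneg ε)).trans ?_
    rw [← mul_div_assoc, div_le_iff₀ (by linarith)]
    linarith
  refine key.trans ?_
  have h3 : 3 * ε ^ 2 * (∫ h, pullCount (B i) n h ∂P) / (2 * (1 / 32)) + 2 * (1 / 32) ≤ 1 / 8 := by
    have h4 : 3 * ε ^ 2 * (∫ h, pullCount (B i) n h ∂P) / (2 * (1 / 32)) =
        48 * (ε ^ 2 * ∫ h, pullCount (B i) n h ∂P) := by ring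
    rw [h4]
    linarith
  have h4 := mul_le_mul_of_nonneg_left h3 (Nat.cast_nonneg (α := ℝ) n)
  linarith

end XBandit

/-! ### Tent-shaped bumps on a metric space. -/

namespace XBandit

variable {X : Type*} [MetricSpace X]

/-- The tent function of height and radius `ε` centred at `x`. -/
def tent (x : X) (ε : ℝ) (y : X) : ℝ := max 0 (ε - dist x y)

theorem abs_tent_le_indicator (x : X) {ε : ℝ} (y : X) :
    |tent x ε y| ≤ (openBall dist x ε).indicator (fun _ => ε) y := by
  rw [tent, abs_of_nonneg (le_max_left _ _)]
  by_cases hy : dist x y < ε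
  · rw [Set.indicator_of_mem (show y ∈ openBall dist x ε from hy)]
    exact max_le (dist_nonneg.trans hy.le) (by linarith [dist_nonneg (x := x) (y := y)])
  · rw [Set.indicator_of_notMem (show y ∉ openBall dist x ε from hy)]
    exact max_le le_rfl (by linarith)

theorem abs_tent_le (x : X) {ε : ℝ} (hε : 0 ≤ ε) (y : X) : |tent x ε y| ≤ ε := by
  rw [tent, abs_of_nonneg (le_max_left _ _)]
  exact max_le hε (by linarith [dist_nonneg (x := x) (y := y)])

theorem tent_self (x : X) {ε : ℝ} (hε : 0 ≤ ε) : tent x ε x = ε := by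
  simp [tent, hε]

theorem tent_sub_tent_le (x : X) (ε : ℝ) (y z : X) : tent x ε y - tent x ε z ≤ dist y z := by
  have h1 := dist_triangle x y z
  have h2 : ε - dist x z ≤ tent x ε z := le_max_right _ _
  have h3 : 0 ≤ tent x ε z := le_max_left _ _
  have h4 : tent x ε y ≤ tent x ε z + dist y z :=
    max_le (by linarith [dist_nonneg (x := y) (y := z)]) (by linarith)
  linarith

variable [MeasurableSpace X]

theorem measurable_tent {x : X} (hx : ∀ r : ℝ, MeasurableSet (openBall dist x r)) (ε : ℝ) :
    Measurable (tent x ε) := by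
  have : Measurable fun y => dist x y := measurable_of_Iio hx
  unfold tent
  fun_prop

variable {x : X} {ε : ℝ} (hm : Measurable (tent x ε)) (hb : ∀ y, |tent x ε y| ≤ 1 / 4)

theorem bestPayoff_tent (hε : 0 ≤ ε) : (bernoulliEnv (tent x ε) hm hb).bestPayoff = 1 / 2 + ε := by
  have : Nonempty X := ⟨x⟩
  have hle (y : X) : (bernoulliEnv (tent x ε) hm hb).meanPayoff y ≤ 1 / 2 + ε := by
    rw [meanPayoff_bernoulliEnv]
    linarith [(abs_le.1 (abs_tent_le x hε y)).2]
  refine le_antisymm (ciSup_le hle) ?_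
  refine le_ciSup_of_le ⟨_, Set.forall_mem_range.2 hle⟩ x ?_
  rw [meanPayoff_bernoulliEnv, tent_self x hε]

/-- The tent is 1-Lipschitz, so the distance term of the maximum suffices. -/
theorem weaklyLipschitz_tent : (bernoulliEnv (tent x ε) hm hb).WeaklyLipschitz dist := by
  intro y z
  have h1 := tent_sub_tent_le x ε y z
  have h2 := le_max_right ((bernoulliEnv (tent x ε) hm hb).bestPayoff -
    (bernoulliEnv (tent x ε) hm hb).meanPayoff y) (dist y z)
  rw [meanPayoff_bernoulliEnv, meanPayoff_bernoulliEnv] at *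
  linarith

/-- A round outside the ball costs exactly `ε`; a round inside costs at least `0`. -/
theorem le_expectedRegret_tent (hε : 0 ≤ ε) (φ : Strategy X) (n : ℕ)
    (hB : MeasurableSet (openBall dist x ε)) :
    ε * (n - ∫ h, pullCount (openBall dist x ε) n h
        ∂(historyLaw φ (bernoulliEnv (tent x ε) hm hb) n)) ≤
      expectedRegret φ (bernoulliEnv (tent x ε) hm hb) n := by
  set P := historyLaw φ (bernoulliEnv (tent x ε) hm hb) n
  have hT := integrable_pullCount hB n P
  have hs : Integrable (fun h : Fin n → X × I => ∑ t, (1 / 2 + tent x ε (h t).1)) P :=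
    integrable_sum_of_abs_le (g := fun p : X × I => 1 / 2 + tent x ε p.1) (C := 1 / 2 + 1 / 4)
      (by fun_prop) (fun p => (abs_add_le _ _).trans (by
        rw [abs_of_pos (by norm_num : (0 : ℝ) < 1 / 2)]
        linarith [hb p.1])) n P
  have e : ε * (n - ∫ h, pullCount (openBall dist x ε) n h ∂P) =
      ∫ h, ε * (n - pullCount (openBall dist x ε) n h) ∂P := by
    rw [integral_const_mul, integral_sub (integrable_const _) hT]
    simp
  unfold expectedRegret
  simp only [meanPayoff_bernoulliEnv, bestPayoff_tent hm hb hε]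
  rw [e]
  refine integral_mono (((integrable_const _).sub hT).const_mul ε)
    ((integrable_const _).sub hs) fun h => ?_
  have h1 : ∑ t, (1 / 2 + tent x ε (h t).1) ≤
      ∑ t, (1 / 2 + ε * (openBall dist x ε).indicator (1 : X → ℝ) (h t).1) := by
    refine Finset.sum_le_sum fun t _ => ?_
    have := (le_abs_self _).trans (abs_tent_le_indicator x (ε := ε) (h t).1)
    by_cases hx : (h t).1 ∈ openBall dist x ε <;> simp_all
  have h2 : ∑ t, (1 / 2 + ε * (openBall dist x ε).indicator (1 : X → ℝ) (h t).1) =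
      n * (1 / 2) + ε * pullCount (openBall dist x ε) n h := by
    rw [Finset.sum_add_distrib, ← Finset.mul_sum]
    simp [pullCount]
  linarith

end XBandit

/-! ### Packings and tuning of the radius. -/

theorem XBandit.exists_packing {X : Type*} {ℓ : X → X → ℝ} {ε : ℝ} {m : ℕ} (hm : m ≠ 0)
    (h : (m : ℕ∞) ≤ XBandit.packingNumber X ℓ ε) :
    ∃ k, m ≤ k ∧ ∃ x : Fin k → X, Pairwise fun i j =>
      Disjoint (XBandit.openBall ℓ (x i) ε) (XBandit.openBall ℓ (x j) ε) := by
  by_contra! hcon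
  have : XBandit.packingNumber X ℓ ε ≤ ((m - 1 : ℕ) : ℕ∞) := by
    refine iSup₂_le fun k hk => ?_
    by_cases hmk : m ≤ k
    · obtain ⟨x, hx⟩ := hk
      exact absurd hx (hcon k hmk x)
    · exact_mod_cast (by omega : k ≤ m - 1)
  have h2 := h.trans this
  norm_cast at h2
  omega

end

theorem theorem6 (c D : ℝ) (hc : 0 < c) (hD : 0 ≤ D) :
    ∃ (N : ℕ) (γ : ℝ), 0 < γ ∧
      ∀ (X : Type*) [MetricSpace X] [MeasurableSpace X],
        (∀ (x : X) (r : ℝ), MeasurableSet (XBandit.openBall dist x r)) →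
        (∀ ε : ℝ, 0 < ε → ε < 1 / 2 →
          ENNReal.ofReal (c * ε ^ (-D)) ≤ (XBandit.packingNumber X dist ε : ℝ≥0∞) ∧
          2 ≤ XBandit.packingNumber X dist ε) →
        ∀ (φ : XBandit.Strategy X) (n : ℕ), N ≤ n →
          ((γ * (n : ℝ) ^ ((D + 1) / (D + 2)) : ℝ) : EReal) ≤
            ⨆ (M : XBandit.Environment X) (_ : M.WeaklyLipschitz dist),
              ((XBandit.expectedRegret φ M n : ℝ) : EReal) := by
  have hD2 : 0 < D + 2 := by linarith
  -- The threshold amounts to `ε ≤ 1/4` for the radius below; `3/8 = 1 - 5/8` is the fraction of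
  -- rounds spent off the bump.
  refine ⟨⌈c / 768 * 4 ^ (D + 2)⌉₊ + 1, 3 / 8 * (c / 768) ^ (1 / (D + 2)), by positivity, ?_⟩
  intro X _ _ hball hpack φ n hn
  have hn0 : (0 : ℝ) < n := by exact_mod_cast (by omega : 0 < n)
  have hnc : c / 768 * 4 ^ (D + 2) ≤ n :=
    (Nat.le_ceil _).trans (by exact_mod_cast (by omega : ⌈c / 768 * 4 ^ (D + 2)⌉₊ ≤ n))
  -- This `ε` solves `768 n ε² = c ε^(-D)`, the largest radius for which the packing bound ensures
  -- `768 n ε² ≤ K`.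
  set ε : ℝ := (c / 768 / n) ^ (1 / (D + 2)) with hεdef
  have hε0 : 0 < ε := by positivity
  have hεpow : ε ^ (D + 2) = c / 768 / n := by
    rw [hεdef, ← Real.rpow_mul (by positivity), one_div_mul_cancel hD2.ne', Real.rpow_one]
  have hε4 : ε ≤ 1 / 4 := by
    refine (Real.rpow_le_rpow_iff hε0.le (by norm_num) hD2).1 ?_
    rw [hεpow, Real.div_rpow (by norm_num) (by norm_num), Real.one_rpow,
      div_le_div_iff₀ hn0 (by positivity)]
    linarith
  obtain ⟨hp1, hp2⟩ := hpack ε hε0 (by linarith)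
  have hceil : ((max 2 ⌈c * ε ^ (-D)⌉₊ : ℕ) : ℕ∞) ≤ XBandit.packingNumber X dist ε := by
    rw [(Nat.mono_cast (α := ℕ∞)).map_max]
    refine max_le hp2 ?_
    -- The packing number may be infinite; finitely many balls are enough.
    cases hN : XBandit.packingNumber X dist ε with
    | top => exact le_top
    | coe m =>
      rw [hN] at hp1
      simp only [ENat.toENNReal_coe] at hp1
      rw [← ENNReal.ofReal_natCast, ENNReal.ofReal_le_ofReal_iff (by positivity)] at hp1
      exact_mod_cast Nat.ceil_le.2 hp1
  obtain ⟨K, hmK, x, hx⟩ := XBandit.exists_packing (by omega) hceil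
  have hK2 : 2 ≤ K := (le_max_left _ _).trans hmK
  have hKc : c * ε ^ (-D) ≤ K :=
    (Nat.le_ceil _).trans (by exact_mod_cast (le_max_right _ _).trans hmK)
  have hnK : 768 * (n * ε ^ 2) ≤ (K : ℝ) := by
    refine le_trans (le_of_eq ?_) hKc
    have h1 : ε ^ (D + 2) = ε ^ D * ε ^ 2 := by
      rw [Real.rpow_add hε0]
      norm_num
    have h2 : 0 < ε ^ D := by positivity
    rw [Real.rpow_neg hε0.le]
    rw [h1] at hεpow
    field_simp at hεpow ⊢
    linarith
  have hm (i : Fin K) := XBandit.measurable_tent (hball (x i)) ε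
  have hb (i : Fin K) (y : X) : |XBandit.tent (x i) ε y| ≤ 1 / 4 :=
    (XBandit.abs_tent_le (x i) hε0.le y).trans hε4
  obtain ⟨i, hi⟩ := XBandit.exists_integral_pullCount_le φ hK2
    (fun i => hball (x i) ε) hx hm hb (fun i => XBandit.abs_tent_le_indicator (x i)) n hnK
  refine le_iSup₂_of_le (XBandit.bernoulliEnv _ (hm i) (hb i))
    (XBandit.weaklyLipschitz_tent (hm i) (hb i)) ?_
  rw [EReal.coe_le_coe_iff]
  refine le_trans ?_ (XBandit.le_expectedRegret_tent (hm i) (hb i) hε0.le φ n (hball (x i) ε))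
  have hrate : 3 / 8 * (c / 768) ^ (1 / (D + 2)) * (n : ℝ) ^ ((D + 1) / (D + 2)) =
      ε * (3 / 8 * n) := by
    rw [hεdef, Real.div_rpow (by positivity) hn0.le,
      show (D + 1) / (D + 2) = 1 - 1 / (D + 2) by field_simp; ring,
      Real.rpow_sub hn0, Real.rpow_one]
    ring
  rw [hrate]
  gcongr
  linarith
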